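/- There exist a finite alphabet $\Sigma$, a letter $\hat q\in\Sigma$, a language $L\subseteq\Sigma^*$ and a monoid morphism $\varphi:\Sigma^*\to\mathbb{Q}^{2\times 2}$ with $$\varphi(\hat q)=\begin{pmatrix}3/5&4/5\\-4/5&3/5\end{pmatrix},\qquad \varphi(c)=I\ \text{ for every letter } c\in\Sigma\setminus\{\hat q\}$$ (so that $\varphi$ assigns an orthogonal matrix to every word of $\Sigma^*$), such that: (i) the complement $\Sigma^*\setminus L$ is a context-free language; (ii) the topological closure $\mathbf{Cl}(\varphi(L))$ in $\mathbb{R}^{2\times 2}$ is not semialgebraic, where a set of $2\times 2$ matrices is called semialgebraic if, as a subset of $\mathbb{R}^4$, it is a finite Boolean combination of sets of the form $\{x : p(x)>0\}$ with $p$ a polynomial with real coefficients; (iii) $\mathbf{Cl}(\varphi(L))$ has exactly one limit point, namely the identity matrix $I$, and infinitely many isolated points. -/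

import Mathlib

open Topology

/-- Semialgebraic subsets of `ℝ^ι`: the finite Boolean combinations of the sets `{x | p x > 0}`,
where `p` is a polynomial with real coefficients. -/
inductive IsSemialgebraic {ι : Type*} : Set (ι → ℝ) → Prop
  | pos (p : MvPolynomial ι ℝ) : IsSemialgebraic {x | 0 < MvPolynomial.eval x p}
  | compl {A : Set (ι → ℝ)} : IsSemialgebraic A → IsSemialgebraic Aᶜ
  | union {A B : Set (ι → ℝ)} : IsSemialgebraic A → IsSemialgebraic B → IsSemialgebraic (A ∪ B)
  | inter {A B : Set (ι → ℝ)} : IsSemialgebraic A → IsSemialgebraic B → IsSemialgebraic (A ∩ B)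

/-- A set of real `n × n` matrices is semialgebraic if it is so as a set of vectors of
dimension `n²`, the coordinates being the entries of the matrix. -/
def IsSemialgebraicMatrixSet {n : ℕ} (A : Set (Matrix (Fin n) (Fin n) ℝ)) : Prop :=
  IsSemialgebraic {x : Fin n × Fin n → ℝ | Matrix.of (fun i j => x (i, j)) ∈ A}

/-- The set `φ(L)` of the matrices assigned to the words of the language `L`,
seen as a set of real matrices. -/
def matrixImage {Γ : Type*} {n : ℕ} (φ : FreeMonoid Γ →* Matrix (Fin n) (Fin n) ℚ)
    (L : Language Γ) : Set (Matrix (Fin n) (Fin n) ℝ) :=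
  {A | ∃ w : List Γ, w ∈ L ∧ A = (φ (FreeMonoid.ofList w)).map (fun r : ℚ => (r : ℝ))}

/-!
The matrix `φ(q)` is the rotation given by the complex number `z = (3 + 4i) / 5`, so only the
number `n` of letters `q` in a word matters. The language is built so that the numbers which occur
are the *records* (`IsRotRecord`): the `n` for which `Re (z ^ n)` exceeds the real parts of all
smaller positive powers. As `z` is not a root of unity and its powers come arbitrarily close to `1`,
there are infinitely many records, and `z ^ n` tends to `1` along them. Hence the matrices of the
records form a closed infinite set whose only limit point is the identity
(`derivedSet_recordMatrices`). A rational parametrization of the circle pulls this set back to a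
countable infinite subset of the line, whereas it pulls a semialgebraic set back to one with a
finite boundary (`IsSemialgebraic.finite_frontier_preimage`).

A word with `n` letters `q` is read as blocks `u₀ q u₁ q ⋯ q uₙ`, each of which encodes a vector
of `ℤ³` in unary: the real and the imaginary part of a multiple of `(3 + 4i) ^ j`, and an upper
bound for `5 ^ j` times the real parts met so far. That the blocks follow the recursion, and that
the last one beats the bound, are finitely many linear inequalities between consecutive blocks
(`recordTest`). A word lies outside the language if and only if one of them fails somewhere, which a
nondeterministic automaton with an integer counter can guess (`testAutomaton`). The languages of
such automata are context-free (`CounterAutomaton.isContextFree_language`): a run of small weight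
splits into two runs of small weight, so finitely many nonterminals are enough.
-/

/-! ### A criterion for context-freeness -/

/-- The language denoted by a sentential form, when the nonterminal `A` stands for the
language `S A`. -/
def formLanguage {T N : Type*} (S : N → Language T) (l : List (Symbol T N)) : Language T :=
  (l.map fun
    | .terminal a => {[a]}
    | .nonterminal A => S A).prod

theorem formLanguage_append {T N : Type*} (S : N → Language T) (l₁ l₂ : List (Symbol T N)) :
    formLanguage S (l₁ ++ l₂) = formLanguage S l₁ * formLanguage S l₂ := by
  simp [formLanguage]

theorem formLanguage_map_terminal {T N : Type*} (S : N → Language T) (w : List T) :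
    formLanguage S (w.map Symbol.terminal) = {w} := by
  induction w with
  | nil => rfl
  | cons a w ih =>
    have h : formLanguage S ((a :: w).map Symbol.terminal) =
        ({[a]} : Language T) * formLanguage S (w.map Symbol.terminal) := by
      simp [formLanguage]
    rw [h, ih]
    ext x
    rw [Language.mem_mul]
    constructor
    · rintro ⟨u, hu, v, hv, rfl⟩
      rw [Set.mem_singleton_iff.1 hu, Set.mem_singleton_iff.1 hv]
      exact Set.mem_singleton _
    · intro hx
      exact ⟨[a], Set.mem_singleton _, w, Set.mem_singleton _, (Set.mem_singleton_iff.1 hx).symm⟩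

theorem formLanguage_nonterminal {T N : Type*} (S : N → Language T) (A : N) :
    formLanguage S [Symbol.nonterminal A] = S A := by
  simp [formLanguage]

/-- The rules with at most two symbols on the right that are sound for the family `S`. -/
def soundRules {T N : Type*} (S : N → Language T) : Set (ContextFreeRule T N) :=
  {r | r.output.length ≤ 2 ∧ formLanguage S r.output ≤ S r.input}

theorem finite_soundRules {T N : Type*} [Finite T] [Finite N] (S : N → Language T) :
    (soundRules S).Finite := by
  have : Finite (Symbol T N) := by
    refine Finite.of_injective (β := T ⊕ N)
      (fun | .terminal a => Sum.inl a | .nonterminal A => Sum.inr A) ?_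
    rintro (a | a) (b | b) h <;> simp_all
  have hfin : {x : N × List (Symbol T N) | x.2.length ≤ 2}.Finite :=
    (Set.finite_univ.prod (List.finite_length_le (Symbol T N) 2)).subset
      fun x hx => ⟨Set.mem_univ _, hx⟩
  refine Set.Finite.of_finite_image (f := fun r => (r.input, r.output))
    (hfin.subset ?_) ?_
  · rintro _ ⟨r, hr, rfl⟩
    exact hr.1
  · intro r _ r' _ h
    simp only [Prod.mk.injEq] at h
    exact ContextFreeRule.ext h.1 h.2

/-- A finite family of languages is context-free as soon as every long word of a member splits
into shorter words of two members whose product is contained in that member: the grammar that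
has all sound rules of length at most two then generates the family. -/
theorem Language.isContextFree_of_split {T : Type*} {N : Type} [Finite T] [Finite N]
    (S : N → Language T)
    (hS : ∀ A, ∀ w ∈ S A, 2 ≤ w.length → ∃ B C u v, u ≠ [] ∧ v ≠ [] ∧ u ++ v = w ∧
      u ∈ S B ∧ v ∈ S C ∧ S B * S C ≤ S A) (A : N) : (S A).IsContextFree := by
  let g : ContextFreeGrammar T := ⟨N, A, (finite_soundRules S).toFinset⟩
  have hrules : ∀ r, r ∈ g.rules ↔ r ∈ soundRules S := fun r => by simp [g]
  have hsound : ∀ l₁ l₂, g.Derives l₁ l₂ → formLanguage S l₂ ≤ formLanguage S l₁ := by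
    intro l₁ l₂ h
    induction h with
    | refl => exact le_rfl
    | tail _ h ih =>
      refine le_trans ?_ ih
      obtain ⟨r, hr, hrw⟩ := h
      obtain ⟨p, q, rfl, rfl⟩ := hrw.exists_parts
      have := ((hrules r).1 hr).2
      simp only [formLanguage_append, formLanguage_nonterminal]
      gcongr
  have hrule : ∀ (B : N) (l : List (Symbol T N)), l.length ≤ 2 → formLanguage S l ≤ S B →
      g.Derives [Symbol.nonterminal B] l := by
    intro B l hl hle
    exact ContextFreeGrammar.Produces.single
      ⟨⟨B, l⟩, (hrules _).2 ⟨hl, hle⟩, ContextFreeRule.Rewrites.input_output⟩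
  have hcomplete : ∀ n, ∀ w : List T, w.length = n → ∀ B, w ∈ S B →
      g.Derives [Symbol.nonterminal B] (w.map Symbol.terminal) := by
    intro n
    induction n using Nat.strong_induction_on with
    | _ n ih =>
      rintro w rfl B hw
      by_cases hlen : 2 ≤ w.length
      · obtain ⟨C, D, u, v, hu, hv, rfl, huC, hvD, hle⟩ := hS B w hw hlen
        have hu' := List.length_pos_of_ne_nil hu
        have hv' := List.length_pos_of_ne_nil hv
        have h1 := ih u.length (by simp; omega) u rfl C huC
        have h2 := ih v.length (by simp; omega) v rfl D hvD
        have h0 := hrule B [Symbol.nonterminal C, Symbol.nonterminal D] (by simp)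
          (by simpa [formLanguage] using hle)
        rw [List.map_append]
        exact h0.trans ((h1.append_right [Symbol.nonterminal D]).trans
          (h2.append_left (u.map Symbol.terminal)))
      · refine hrule B _ (by simp; omega) ?_
        rw [formLanguage_map_terminal]
        exact Set.singleton_subset_iff.2 hw
  refine ⟨g, ?_⟩
  ext w
  rw [ContextFreeGrammar.mem_language_iff]
  constructor
  · intro h
    have h' := hsound _ _ h
    rw [formLanguage_map_terminal, formLanguage_nonterminal] at h'
    exact h' (Set.mem_singleton w)
  · exact fun h => hcomplete _ w rfl A h

/-! ### Counter automata without zero tests -/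

/-- A nondeterministic automaton with an integer counter that it cannot test: reading the letter
`a` in the state `p` adds `weight p a` to the counter. -/
structure CounterAutomaton (T Q : Type*) where
  /-- The transitions. -/
  step : Q → T → Q → Prop
  /-- The increment of the counter. -/
  weight : Q → T → ℤ
  /-- The initial states. -/
  start : Set Q
  /-- The accepting states. -/
  accept : Set Q

namespace CounterAutomaton

variable {T Q : Type*} (M : CounterAutomaton T Q)

/-- `M.Run p w k r`: the automaton can go from `p` to `r` reading `w`, which adds `k` to the
counter. -/
def Run : Q → List T → ℤ → Q → Prop
  | p, [], k, r => k = 0 ∧ p = r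
  | p, a :: w, k, r => ∃ s, M.step p a s ∧ Run s w (k - M.weight p a) r

/-- The words read by a run from an initial to an accepting state that increases the counter. -/
def language : Language T :=
  {w | ∃ p ∈ M.start, ∃ r ∈ M.accept, ∃ k, 0 < k ∧ M.Run p w k r}

variable {M}

theorem Run.append {p s r : Q} {u v : List T} {i j : ℤ} (hu : M.Run p u i s)
    (hv : M.Run s v j r) : M.Run p (u ++ v) (i + j) r := by
  induction u generalizing p i with
  | nil =>
    obtain ⟨rfl, rfl⟩ := hu
    simpa using hv
  | cons a u ih =>
    obtain ⟨t, ht, hu⟩ := hu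
    refine ⟨t, ht, ?_⟩
    have := ih hu
    rwa [show i + j - M.weight p a = i - M.weight p a + j by ring]

/-- The counter values and the states along a run. -/
theorem Run.exists_path {b : ℤ} (hb : ∀ p a, |M.weight p a| ≤ b) {p r : Q} {w : List T} {k : ℤ}
    (h : M.Run p w k r) : ∃ (s : ℕ → ℤ) (t : ℕ → Q), s 0 = 0 ∧ s w.length = k ∧
      (∀ i < w.length, |s (i + 1) - s i| ≤ b) ∧
      ∀ i ≤ w.length, M.Run p (w.take i) (s i) (t i) ∧ M.Run (t i) (w.drop i) (k - s i) r := by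
  induction w generalizing p k with
  | nil =>
    obtain ⟨rfl, rfl⟩ := h
    exact ⟨fun _ => 0, fun _ => p, rfl, rfl, by simp, by simp [Run]⟩
  | cons a w ih =>
    obtain ⟨q, hq, hw⟩ := h
    obtain ⟨s, t, h0, hl, hs, ht⟩ := ih hw
    refine ⟨fun | 0 => 0 | i + 1 => M.weight p a + s i, fun | 0 => p | i + 1 => t i,
      rfl, by simp [hl], ?_, ?_⟩
    · rintro (_ | i) hi
      · simpa [h0] using hb p a
      · simpa using hs i (by simpa using hi)
    · rintro (_ | i) hi
      · simpa [Run] using ⟨q, hq, hw⟩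
      · obtain ⟨h1, h2⟩ := ht i (by simpa using hi)
        refine ⟨⟨q, hq, by simpa using h1⟩, ?_⟩
        simpa [sub_sub] using h2

/-- A walk of at least two steps of size at most `b` that ends in `[-b, b]` can be cut into two
walks that do so. -/
theorem exists_balanced_cut {b k : ℤ} {n : ℕ} (hn : 2 ≤ n) {s : ℕ → ℤ} (h0 : s 0 = 0)
    (hk : s n = k) (hkb : |k| ≤ b) (hs : ∀ i < n, |s (i + 1) - s i| ≤ b) :
    ∃ i, 0 < i ∧ i < n ∧ |s i| ≤ b ∧ |k - s i| ≤ b := by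
  wlog hk0 : 0 ≤ k generalizing s k
  · obtain ⟨i, h1, h2, h3, h4⟩ := this (s := fun i => -s i) (k := -k) (by simp [h0])
      (by simp [hk]) (by simpa using hkb)
      (fun i hi => by
        have := hs i hi
        rw [abs_le] at this ⊢
        constructor <;> linarith [this.1, this.2]) (by omega)
    refine ⟨i, h1, h2, by simpa using h3, ?_⟩
    rw [abs_le] at h4 ⊢
    constructor <;> linarith [h4.1, h4.2]
  by_contra! hcon
  simp only [abs_le] at hkb hs
  -- Without a cut the walk stays below `k - b`, too far from its end point.
  have hlow : ∀ i, i + 1 < n → s (i + 1) < k - b := by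
    intro i
    induction i with
    | zero =>
      intro hi
      by_contra! hge
      have h1 := hs 0 (by omega)
      have := hcon (0 + 1) (by omega) hi (abs_le.2 ⟨by linarith, by linarith [h1.2]⟩)
      exact this.not_ge (abs_le.2 ⟨by linarith [h1.2], by linarith⟩)
    | succ i ih =>
      intro hi
      by_contra! hge
      have h1 := hs (i + 1) (by omega)
      have h2 := ih (by omega)
      have := hcon (i + 1 + 1) (by omega) hi (abs_le.2 ⟨by linarith, by linarith [h1.2]⟩)
      exact this.not_ge (abs_le.2 ⟨by linarith [h1.2], by linarith⟩)
  obtain ⟨m, rfl⟩ : ∃ m, n = m + 2 := ⟨n - 2, by omega⟩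
  have h1 := hlow m (by omega)
  have h2 := hs (m + 1) (by omega)
  rw [show m + 1 + 1 = m + 2 from rfl, hk] at h2
  linarith [h2.2]

/-- A walk with steps of size at most `b` that ends above `b` can be cut into two walks that end
above `0`, the first of them not above `b`. -/
theorem exists_positive_cut {b k : ℤ} {n : ℕ} (hb : 0 ≤ b) {s : ℕ → ℤ} (h0 : s 0 = 0)
    (hk : s n = k) (hkb : b < k) (hs : ∀ i < n, |s (i + 1) - s i| ≤ b) :
    ∃ i, 0 < i ∧ i < n ∧ 0 < s i ∧ 0 < k - s i := by
  classical
  have hex : ∃ i, 0 < s i := ⟨n, by omega⟩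
  have hpos := Nat.find_spec hex
  have hle : Nat.find hex ≤ n := Nat.find_min' hex (by omega)
  have hne : Nat.find hex ≠ 0 := fun h => by rw [h, h0] at hpos; omega
  obtain ⟨j, hj⟩ := Nat.exists_eq_succ_of_ne_zero hne
  have hprev : ¬ 0 < s j := Nat.find_min hex (by omega)
  have hstep := (abs_le.1 (hs j (by omega))).2
  rw [hj] at hpos hle
  have hlt : s (j + 1) < k := by omega
  refine ⟨j + 1, by omega, lt_of_le_of_ne hle fun h => ?_, hpos, by omega⟩
  rw [h, hk] at hlt
  exact lt_irrefl _ hlt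

/-- The language of a counter automaton is context-free. The nonterminals stand for the runs
between two given states whose weight is a given number in `[-b, b]`, or positive, where `b` bounds
the weights of the letters. -/
theorem isContextFree_language {T : Type*} {Q : Type} [Finite T] [Finite Q]
    (M : CounterAutomaton T Q) : M.language.IsContextFree := by
  obtain ⟨b, hb0, hb⟩ : ∃ b : ℤ, 0 ≤ b ∧ ∀ p a, |M.weight p a| ≤ b := by
    obtain ⟨b, hb⟩ := (Set.finite_range fun x : Q × T => |M.weight x.1 x.2|).bddAbove
    exact ⟨max b 0, le_max_right _ _, fun p a => le_max_of_le_left (hb ⟨(p, a), rfl⟩)⟩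
  let S : Option (Q × Q × Option (Set.Icc (-b) b)) → Language T
    | none => M.language
    | some (p, r, some k) => {w | M.Run p w k r}
    | some (p, r, none) => {w | ∃ k, 0 < k ∧ M.Run p w k r}
  -- A run with a small weight splits into two such runs.
  have hexact : ∀ p r k w, M.Run p w k r → |k| ≤ b → 2 ≤ w.length →
      ∃ (s : Q) (i j : Set.Icc (-b) b) (u v : List T),
        u ≠ [] ∧ v ≠ [] ∧ u ++ v = w ∧ (i : ℤ) + j = k ∧
        u ∈ S (some (p, s, some i)) ∧ v ∈ S (some (s, r, some j)) := by
    intro p r k w hw hk hlen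
    obtain ⟨s, t, h0, hl, hs, ht⟩ := hw.exists_path hb
    obtain ⟨i, hi0, hi, h1, h2⟩ := exists_balanced_cut hlen h0 hl hk hs
    refine ⟨t i, ⟨s i, abs_le.1 h1⟩, ⟨k - s i, abs_le.1 h2⟩, w.take i, w.drop i, ?_, ?_,
      List.take_append_drop i w, by simp, (ht i hi.le).1, (ht i hi.le).2⟩
    · rw [← List.length_pos_iff_ne_nil, List.length_take]; omega
    · rw [← List.length_pos_iff_ne_nil, List.length_drop]; omega
  -- A run with a positive weight splits into two small or two positive runs.
  have hpos : ∀ p r k w, M.Run p w k r → 0 < k → 2 ≤ w.length →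
      ∃ B C u v, u ≠ [] ∧ v ≠ [] ∧ u ++ v = w ∧ u ∈ S B ∧ v ∈ S C ∧
        S B * S C ≤ S (some (p, r, none)) := by
    intro p r k w hw hk hlen
    by_cases hkb : k ≤ b
    · obtain ⟨s, i, j, u, v, hu, hv, huv, hij, hu', hv'⟩ :=
        hexact p r k w hw (abs_le.2 ⟨by linarith, hkb⟩) hlen
      refine ⟨some (p, s, some i), some (s, r, some j), u, v, hu, hv, huv, hu', hv', ?_⟩
      rintro _ ⟨x, hx, y, hy, rfl⟩
      exact ⟨i + j, hij ▸ hk, Run.append hx hy⟩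
    · obtain ⟨s, t, h0, hl, hs, ht⟩ := hw.exists_path hb
      obtain ⟨i, hi0, hi, h1, h2⟩ := exists_positive_cut hb0 h0 hl (not_le.1 hkb) hs
      refine ⟨some (p, t i, none), some (t i, r, none), w.take i, w.drop i, ?_, ?_,
        List.take_append_drop i w, ⟨_, h1, (ht i hi.le).1⟩, ⟨_, h2, (ht i hi.le).2⟩, ?_⟩
      · rw [← List.length_pos_iff_ne_nil, List.length_take]; omega
      · rw [← List.length_pos_iff_ne_nil, List.length_drop]; omega
      · rintro _ ⟨x, ⟨i, hi, hx⟩, y, ⟨j, hj, hy⟩, rfl⟩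
        exact ⟨i + j, by omega, hx.append hy⟩
  refine Language.isContextFree_of_split S ?_ none
  rintro (_ | ⟨p, r, _ | k⟩) w hw hlen
  · obtain ⟨p, hp, r, hr, k, hk, hw⟩ := hw
    obtain ⟨B, C, u, v, hu, hv, huv, hu', hv', hle⟩ := hpos p r k w hw hk hlen
    refine ⟨B, C, u, v, hu, hv, huv, hu', hv', hle.trans ?_⟩
    rintro x ⟨k, hk, hx⟩
    exact ⟨p, hp, r, hr, k, hk, hx⟩
  · obtain ⟨k, hk, hw⟩ := hw
    exact hpos p r k w hw hk hlen
  · obtain ⟨s, i, j, u, v, hu, hv, huv, hij, hu', hv'⟩ :=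
      hexact p r k w hw (abs_le.2 k.2) hlen
    refine ⟨some (p, s, some i), some (s, r, some j), u, v, hu, hv, huv, hu', hv', ?_⟩
    rintro _ ⟨x, hx, y, hy, rfl⟩
    have := Run.append hx hy
    rwa [hij] at this

end CounterAutomaton

/-! ### Words as sequences of blocks -/

/-- The alphabet: `none` is the separator, the letter that is mapped to the rotation; `some (i, b)`
counts for `+1` (if `b`) or `-1` (otherwise) in the `i`-th coordinate of a block. -/
abbrev BlockLetter : Type := Option (Fin 3 × Bool)

/-- The vector in `ℤ³` that a letter stands for. -/
def letterVec : BlockLetter → Fin 3 → ℤ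
  | none => 0
  | some (i, b) => Pi.single i (if b then 1 else -1)

/-- The vector in `ℤ³` that a block encodes in unary. -/
def blockVec (u : List (Fin 3 × Bool)) : Fin 3 → ℤ :=
  (u.map fun c => letterVec (some c)).sum

theorem exists_blockVec_eq (v : Fin 3 → ℤ) : ∃ u, blockVec u = v := by
  have happ : ∀ u u', blockVec (u ++ u') = blockVec u + blockVec u' := by simp [blockVec]
  have hone : ∀ (i : Fin 3) (m : ℤ), ∃ u, blockVec u = Pi.single i m := by
    intro i m
    refine ⟨List.replicate m.natAbs (i, decide (0 ≤ m)), ?_⟩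
    have h : (m.natAbs : ℤ) * (if 0 ≤ m then 1 else -1) = m := by
      split_ifs with h0
      · simp [abs_of_nonneg h0]
      · simp [abs_of_neg (not_le.1 h0)]
    ext j
    simp only [blockVec, letterVec, List.map_replicate, List.sum_replicate, decide_eq_true_eq,
      Pi.smul_apply, nsmul_eq_mul]
    by_cases hj : j = i
    · subst hj
      simpa using h
    · simp [hj]
  obtain ⟨u₀, h₀⟩ := hone 0 (v 0)
  obtain ⟨u₁, h₁⟩ := hone 1 (v 1)
  obtain ⟨u₂, h₂⟩ := hone 2 (v 2)
  refine ⟨u₀ ++ (u₁ ++ u₂), ?_⟩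
  rw [happ, happ, h₀, h₁, h₂]
  ext j
  fin_cases j <;> simp

/-- The word `u 0 q u 1 q ⋯ q u n`, where `q` is the separator. -/
def blockWord (u : ℕ → List (Fin 3 × Bool)) : ℕ → List BlockLetter
  | 0 => (u 0).map some
  | n + 1 => (u 0).map some ++ none :: blockWord (fun j => u (j + 1)) n

theorem exists_blockWord_eq (w : List BlockLetter) : ∃ u n, blockWord u n = w := by
  induction w with
  | nil => exact ⟨fun _ => [], 0, rfl⟩
  | cons c w ih =>
    obtain ⟨u, n, rfl⟩ := ih
    cases c with
    | none => exact ⟨fun | 0 => [] | j + 1 => u j, n + 1, rfl⟩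
    | some c =>
      refine ⟨fun | 0 => c :: u 0 | j + 1 => u (j + 1), n, ?_⟩
      cases n <;> rfl

/-! ### Linear tests on consecutive blocks -/

/-- A linear test on two consecutive blocks with vectors `x` and `y`. It fires if
`left ⬝ x + const + right ⬝ y` is positive. -/
structure PairTest where
  /-- The coefficients for the left block. -/
  left : Fin 3 → ℤ
  /-- The coefficients for the right block. -/
  right : Fin 3 → ℤ
  /-- The constant term. -/
  const : ℤ := 0
  /-- Only the first two blocks of the word are tested. -/
  first : Prop := False
  /-- Only the last two blocks of the word are tested. -/
  last : Prop := False

/-- Where an automaton running a test is: before the tested blocks, in the left or in the right one,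
or after them. -/
inductive Phase
  | before | left | right | after

instance : Finite Phase :=
  Finite.of_injective (β := Fin 4) (fun | .before => 0 | .left => 1 | .right => 2 | .after => 3)
    (by rintro (_ | _ | _ | _) (_ | _ | _ | _) h <;> simp_all)

/-- The automaton that guesses a test and a pair of consecutive blocks where this test fires. -/
def testAutomaton {ι : Type} (t : ι → PairTest) : CounterAutomaton BlockLetter (ι × Phase) where
  step := fun p c r => r.1 = p.1 ∧ match p.2, c with
    | .before, some _ => r.2 = .before
    | .before, none => r.2 = .before ∨ r.2 = .left
    | .left, some _ => r.2 = .left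
    | .left, none => r.2 = .right
    | .right, some _ => r.2 = .right
    | .right, none => r.2 = .after
    | .after, _ => r.2 = .after
  weight := fun p c => match p.2, c with
    | .left, some c => (t p.1).left ⬝ᵥ letterVec (some c)
    | .left, none => (t p.1).const
    | .right, some c => (t p.1).right ⬝ᵥ letterVec (some c)
    | _, _ => 0
  start := {p | p.2 = .left ∨ p.2 = .before ∧ ¬ (t p.1).first}
  accept := {p | p.2 = .right ∨ p.2 = .after ∧ ¬ (t p.1).last}

namespace testAutomaton

variable {ι : Type} (t : ι → PairTest)

theorem run_after (i : ι) (w : List BlockLetter) (k : ℤ) (s : ι × Phase) :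
    (testAutomaton t).Run (i, .after) w k s ↔ k = 0 ∧ s = (i, .after) := by
  induction w generalizing k with
  | nil => simp [CounterAutomaton.Run, eq_comm]
  | cons c w ih =>
    have : ∀ r : ι × Phase, (testAutomaton t).step (i, .after) c r ↔ r = (i, .after) := by
      simp [testAutomaton, Prod.ext_iff]
    simp only [CounterAutomaton.Run, this, exists_eq_left, ih]
    simp [testAutomaton]

theorem run_before_block (i : ι) (u : List (Fin 3 × Bool)) (w : List BlockLetter) (k : ℤ)
    (s : ι × Phase) : (testAutomaton t).Run (i, .before) (u.map some ++ w) k s ↔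
      (testAutomaton t).Run (i, .before) w k s := by
  induction u generalizing k with
  | nil => rfl
  | cons c u ih =>
    have : ∀ r : ι × Phase,
        (testAutomaton t).step (i, .before) (some c) r ↔ r = (i, .before) := by
      simp [testAutomaton, Prod.ext_iff]
    simp only [List.map_cons, List.cons_append, CounterAutomaton.Run, this, exists_eq_left, ih]
    simp [testAutomaton]

theorem run_left_block (i : ι) (u : List (Fin 3 × Bool)) (w : List BlockLetter) (k : ℤ)
    (s : ι × Phase) : (testAutomaton t).Run (i, .left) (u.map some ++ w) k s ↔
      (testAutomaton t).Run (i, .left) w (k - (t i).left ⬝ᵥ blockVec u) s := by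
  induction u generalizing k with
  | nil => simp [blockVec]
  | cons c u ih =>
    have : ∀ r : ι × Phase, (testAutomaton t).step (i, .left) (some c) r ↔ r = (i, .left) := by
      simp [testAutomaton, Prod.ext_iff]
    simp only [List.map_cons, List.cons_append, CounterAutomaton.Run, this, exists_eq_left, ih]
    simp [testAutomaton, blockVec, dotProduct_add, sub_sub]

theorem run_right_block (i : ι) (u : List (Fin 3 × Bool)) (w : List BlockLetter) (k : ℤ)
    (s : ι × Phase) : (testAutomaton t).Run (i, .right) (u.map some ++ w) k s ↔
      (testAutomaton t).Run (i, .right) w (k - (t i).right ⬝ᵥ blockVec u) s := by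
  induction u generalizing k with
  | nil => simp [blockVec]
  | cons c u ih =>
    have : ∀ r : ι × Phase, (testAutomaton t).step (i, .right) (some c) r ↔ r = (i, .right) := by
      simp [testAutomaton, Prod.ext_iff]
    simp only [List.map_cons, List.cons_append, CounterAutomaton.Run, this, exists_eq_left, ih]
    simp [testAutomaton, blockVec, dotProduct_add, sub_sub]

theorem run_before_none (i : ι) (w : List BlockLetter) (k : ℤ) (s : ι × Phase) :
    (testAutomaton t).Run (i, .before) (none :: w) k s ↔
      (testAutomaton t).Run (i, .before) w k s ∨ (testAutomaton t).Run (i, .left) w k s := by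
  have : ∀ r : ι × Phase, (testAutomaton t).step (i, .before) none r ↔
      r = (i, .before) ∨ r = (i, .left) := by
    rintro ⟨j, p⟩
    simp only [testAutomaton, Prod.ext_iff]
    tauto
  simp only [CounterAutomaton.Run, this, or_and_right, exists_or, exists_eq_left]
  simp [testAutomaton]

theorem run_left_none (i : ι) (w : List BlockLetter) (k : ℤ) (s : ι × Phase) :
    (testAutomaton t).Run (i, .left) (none :: w) k s ↔
      (testAutomaton t).Run (i, .right) w (k - (t i).const) s := by
  have : ∀ r : ι × Phase, (testAutomaton t).step (i, .left) none r ↔ r = (i, .right) := by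
    simp [testAutomaton, Prod.ext_iff]
  simp only [CounterAutomaton.Run, this, exists_eq_left]
  simp [testAutomaton]

theorem run_right_none (i : ι) (w : List BlockLetter) (k : ℤ) (s : ι × Phase) :
    (testAutomaton t).Run (i, .right) (none :: w) k s ↔ k = 0 ∧ s = (i, .after) := by
  have : ∀ r : ι × Phase, (testAutomaton t).step (i, .right) none r ↔ r = (i, .after) := by
    simp [testAutomaton, Prod.ext_iff]
  simp only [CounterAutomaton.Run, this, exists_eq_left, run_after]
  simp [testAutomaton]

theorem run_nil (p s : ι × Phase) (k : ℤ) :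
    (testAutomaton t).Run p [] k s ↔ k = 0 ∧ p = s := Iff.rfl

/-- The accepting runs that start in the left block test the first two blocks of the word. -/
theorem run_left_blockWord (i : ι) (u : ℕ → List (Fin 3 × Bool)) (n : ℕ) (k : ℤ) :
    (∃ s ∈ (testAutomaton t).accept, (testAutomaton t).Run (i, .left) (blockWord u n) k s) ↔
      0 < n ∧ ((t i).last → n = 1) ∧
        k = (t i).left ⬝ᵥ blockVec (u 0) + (t i).const + (t i).right ⬝ᵥ blockVec (u 1) := by
  have hk : ∀ a b c : ℤ, k - a - b - c = 0 ↔ k = a + b + c := fun a b c => by omega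
  rcases n with _ | _ | n
  · have h := run_left_block t i (u 0) [] k
    simp only [List.append_nil] at h
    simp only [blockWord, h, run_nil]
    simp [testAutomaton]
  · have h := run_right_block t i (u 1) []
    simp only [List.append_nil] at h
    simp only [blockWord, run_left_block, run_left_none, h, run_nil, hk]
    simp [testAutomaton]
  · simp only [blockWord, run_left_block, run_left_none, run_right_block, run_right_none, hk]
    simp [testAutomaton, and_comm]

theorem run_before_blockWord (i : ι) (u : ℕ → List (Fin 3 × Bool)) (n : ℕ) (k : ℤ) :
    (∃ s ∈ (testAutomaton t).accept, (testAutomaton t).Run (i, .before) (blockWord u n) k s) ↔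
      ∃ j, j + 1 < n ∧ ((t i).last → j + 2 = n) ∧
        k = (t i).left ⬝ᵥ blockVec (u (j + 1)) + (t i).const +
          (t i).right ⬝ᵥ blockVec (u (j + 2)) := by
  induction n generalizing u with
  | zero =>
    have h := run_before_block t i (u 0) [] k
    simp only [List.append_nil] at h
    simp only [blockWord, h, run_nil]
    simp [testAutomaton]
  | succ n ih =>
    simp only [blockWord, run_before_block, run_before_none, and_or_left, exists_or, ih,
      run_left_blockWord]
    constructor
    · rintro (⟨j, h1, h2, h3⟩ | ⟨h1, h2, h3⟩)
      · exact ⟨j + 1, by omega, fun h => by have := h2 h; omega, h3⟩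
      · exact ⟨0, by omega, fun h => by have := h2 h; omega, h3⟩
    · rintro ⟨_ | j, h1, h2, h3⟩
      · exact Or.inr ⟨by omega, fun h => by have := h2 h; omega, h3⟩
      · exact Or.inl ⟨j, by omega, fun h => by have := h2 h; omega, h3⟩

theorem blockWord_mem_language (u : ℕ → List (Fin 3 × Bool)) (n : ℕ) :
    blockWord u n ∈ (testAutomaton t).language ↔ ∃ i, ∃ j < n, ((t i).first → j = 0) ∧
      ((t i).last → j + 1 = n) ∧
      0 < (t i).left ⬝ᵥ blockVec (u j) + (t i).const + (t i).right ⬝ᵥ blockVec (u (j + 1)) := by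
  constructor
  · rintro ⟨⟨i, p⟩, hp, r, hr, k, hk, hrun⟩
    refine ⟨i, ?_⟩
    rcases hp with hp | ⟨hp, hfirst⟩
    · simp only at hp
      subst hp
      obtain ⟨h1, h2, rfl⟩ := (run_left_blockWord t i u n k).1 ⟨r, hr, hrun⟩
      exact ⟨0, h1, fun _ => rfl, fun h => (h2 h).symm, hk⟩
    · simp only at hp
      subst hp
      obtain ⟨j, h1, h2, rfl⟩ := (run_before_blockWord t i u n k).1 ⟨r, hr, hrun⟩
      exact ⟨j + 1, h1, fun h => (hfirst h).elim, h2, hk⟩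
  · rintro ⟨i, _ | j, hj, hfirst, hlast, hk⟩
    · obtain ⟨s, hs, hrun⟩ := (run_left_blockWord t i u n _).2 ⟨hj, fun h => (hlast h).symm, rfl⟩
      exact ⟨(i, .left), Or.inl rfl, s, hs, _, hk, hrun⟩
    · obtain ⟨s, hs, hrun⟩ := (run_before_blockWord t i u n _).2 ⟨j, hj, hlast, rfl⟩
      exact ⟨(i, .before), Or.inr ⟨rfl, fun h => by simpa using hfirst h⟩, s, hs, _, hk, hrun⟩

end testAutomaton

/-! ### The records of the rotation -/

/-- The Gaussian integer `3 + 4i`, which is `5` times a rotation of infinite order. -/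
def gaussRot : GaussianInt := ⟨3, 4⟩

theorem gaussRot_pow_succ_re (n : ℕ) :
    (gaussRot ^ (n + 1)).re = 3 * (gaussRot ^ n).re - 4 * (gaussRot ^ n).im := by
  rw [pow_succ', Zsqrtd.re_mul]
  simp [gaussRot]
  ring

theorem gaussRot_pow_succ_im (n : ℕ) :
    (gaussRot ^ (n + 1)).im = 4 * (gaussRot ^ n).re + 3 * (gaussRot ^ n).im := by
  rw [pow_succ', Zsqrtd.im_mul]
  simp [gaussRot]
  ring

/-- `n` is a record if the real part of `((3 + 4i) / 5) ^ n` is larger than that of every smaller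
positive power; the denominators are cleared. In particular `0` and `1` are records. -/
def IsRotRecord (n : ℕ) : Prop :=
  ∀ m, 1 ≤ m → m < n → 5 ^ (n - m) * (gaussRot ^ m).re < (gaussRot ^ n).re

/-- The tests that fire at the errors of a word describing a record. The coordinates `0` and `1` of
the blocks are the real and the imaginary part of a multiple of `(3 + 4i) ^ j`; the coordinate
`2` is an upper bound for the real parts seen so far, scaled by the power of `5` due. -/
def recordTest : Fin 10 → PairTest
  -- the real part is `3 x₀ - 4 x₁`
  | 0 => { left := ![-3, 4, 0], right := ![1, 0, 0] }
  | 1 => { left := ![3, -4, 0], right := ![-1, 0, 0] }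
  -- the imaginary part is `4 x₀ + 3 x₁`
  | 2 => { left := ![-4, -3, 0], right := ![0, 1, 0] }
  | 3 => { left := ![4, 3, 0], right := ![0, -1, 0] }
  -- the bound is at least five times the old one, and at least the real part
  | 4 => { left := ![0, 0, 5], right := ![0, 0, -1] }
  | 5 => { left := 0, right := ![1, 0, -1] }
  -- the first block has imaginary part zero and a nonnegative real part
  | 6 => { left := ![0, 1, 0], right := 0, first := True }
  | 7 => { left := ![0, -1, 0], right := 0, first := True }
  | 8 => { left := ![-1, 0, 0], right := 0, first := True }
  -- the last real part exceeds five times the bound before it; the constant makes the inequality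
  -- strict, so that among words of three or more blocks those starting from zero fail
  | 9 => { left := ![0, 0, 5], right := ![-1, 0, 0], const := 1, last := True }

/-- The words of blocks at which no test fires. -/
def recordLanguage : Language BlockLetter := (testAutomaton recordTest).languageᶜ

theorem isContextFree_compl_recordLanguage : recordLanguageᶜ.IsContextFree := by
  rw [recordLanguage, compl_compl]
  exact CounterAutomaton.isContextFree_language _

theorem blockWord_mem_recordLanguage (u : ℕ → List (Fin 3 × Bool)) (n : ℕ) :
    blockWord u n ∈ recordLanguage ↔
      (∀ j < n, blockVec (u (j + 1)) 0 = 3 * blockVec (u j) 0 - 4 * blockVec (u j) 1 ∧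
        blockVec (u (j + 1)) 1 = 4 * blockVec (u j) 0 + 3 * blockVec (u j) 1 ∧
        5 * blockVec (u j) 2 ≤ blockVec (u (j + 1)) 2 ∧
        blockVec (u (j + 1)) 0 ≤ blockVec (u (j + 1)) 2) ∧
      (0 < n → blockVec (u 0) 1 = 0 ∧ 0 ≤ blockVec (u 0) 0) ∧
      ∀ j, j + 1 = n → 5 * blockVec (u j) 2 < blockVec (u (j + 1)) 0 := by
  have hdot : ∀ (a b c : ℤ) (v : Fin 3 → ℤ),
      ![a, b, c] ⬝ᵥ v = a * v 0 + b * v 1 + c * v 2 := by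
    simp [dotProduct, Fin.sum_univ_three]
  have hmem : blockWord u n ∈ recordLanguage ↔
      ¬ blockWord u n ∈ (testAutomaton recordTest).language := Iff.rfl
  rw [hmem, testAutomaton.blockWord_mem_language]
  push Not
  constructor
  · intro h
    have hpair : ∀ i : Fin 6, ∀ j < n, _ := fun i j hj =>
      h (Fin.castLE (by omega) i) j hj (by fin_cases i <;> exact False.elim)
        (by fin_cases i <;> exact False.elim)
    have hfirst : ∀ i : Fin 3, 0 < n → _ := fun i hn =>
      h (Fin.castLE (by omega) (Fin.natAdd 6 i)) 0 hn (fun _ => rfl)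
        (by fin_cases i <;> exact False.elim)
    refine ⟨fun j hj => ?_, fun hn => ?_, ?_⟩
    · have h0 := hpair 0 j hj
      have h1 := hpair 1 j hj
      have h2 := hpair 2 j hj
      have h3 := hpair 3 j hj
      have h4 := hpair 4 j hj
      have h5 := hpair 5 j hj
      simp [recordTest, hdot] at h0 h1 h2 h3 h4 h5
      omega
    · have h6 := hfirst 0 hn
      have h7 := hfirst 1 hn
      have h8 := hfirst 2 hn
      simp [recordTest, hdot] at h6 h7 h8
      omega
    · rintro j rfl
      have h9 := h 9 j (by omega) (by exact False.elim) (fun _ => rfl)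
      simp [recordTest, hdot] at h9
      omega
  · rintro ⟨hpair, hfirst, hlast⟩ i j hj hi hi'
    have hj' := hpair j hj
    have h0 := hfirst (by omega)
    have hl := hlast j
    fin_cases i <;> simp [recordTest, hdot] at hi hi' ⊢ <;> (try subst hi) <;> omega

theorem IsRotRecord.of_blockWord_mem {u : ℕ → List (Fin 3 × Bool)} {n : ℕ}
    (h : blockWord u n ∈ recordLanguage) : IsRotRecord n := by
  obtain ⟨hstep, hfirst, hlast⟩ := (blockWord_mem_recordLanguage u n).1 h
  intro m hm hmn
  obtain ⟨him, hre⟩ := hfirst (by omega)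
  -- The blocks follow the powers of `3 + 4i`, up to the factor that the first block fixes.
  have horbit : ∀ j ≤ n, blockVec (u j) 0 = blockVec (u 0) 0 * (gaussRot ^ j).re ∧
      blockVec (u j) 1 = blockVec (u 0) 0 * (gaussRot ^ j).im := by
    intro j
    induction j with
    | zero => simp [him]
    | succ j ih =>
      intro hj
      obtain ⟨h0, h1⟩ := ih (by omega)
      obtain ⟨hs0, hs1, -, -⟩ := hstep j (by omega)
      rw [hs0, hs1, h0, h1, gaussRot_pow_succ_re, gaussRot_pow_succ_im]
      constructor <;> ring
  have hbound : ∀ d, m + d < n →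
      5 ^ d * (blockVec (u 0) 0 * (gaussRot ^ m).re) ≤ blockVec (u (m + d)) 2 := by
    intro d
    induction d with
    | zero =>
      intro _
      obtain ⟨k, rfl⟩ : ∃ k, m = k + 1 := ⟨m - 1, by omega⟩
      simpa [← (horbit (k + 1) hmn.le).1] using (hstep k (by omega)).2.2.2
    | succ d ih =>
      intro hd
      have := (hstep (m + d) (by omega)).2.2.1
      rw [pow_succ', ← add_assoc]
      linarith [ih (by omega)]
  obtain ⟨k, rfl⟩ : ∃ k, n = m + k + 1 := ⟨n - m - 1, by omega⟩
  have h1 := hbound k (by omega)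
  have h2 := hlast (m + k) rfl
  rw [(horbit (m + k + 1) le_rfl).1] at h2
  rw [show m + k + 1 - m = k + 1 by omega, pow_succ']
  refine lt_of_mul_lt_mul_left (a := blockVec (u 0) 0) ?_ hre
  linarith

/-- The least admissible bounds: `5 ^ j` times the maximum of `-2` and the real parts of the powers
of `(3 + 4i) / 5` with positive exponent up to `j`. The value `-2`, which all real parts exceed,
keeps the exponent `0` out of the maximum. -/
def recordBound : ℕ → ℤ
  | 0 => -2
  | j + 1 => max (5 * recordBound j) (gaussRot ^ (j + 1)).re

theorem gaussRot_pow_norm (n : ℕ) : (gaussRot ^ n).re ^ 2 + (gaussRot ^ n).im ^ 2 = 25 ^ n := by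
  induction n with
  | zero => simp
  | succ n ih =>
    rw [gaussRot_pow_succ_re, gaussRot_pow_succ_im, pow_succ 25, ← ih]
    ring

theorem neg_five_pow_le_gaussRot_pow_re (n : ℕ) : -5 ^ n ≤ (gaussRot ^ n).re := by
  refine (abs_le_of_sq_le_sq' (b := (5 : ℤ) ^ n) ?_ (by positivity)).1
  rw [← pow_mul, mul_comm n 2, pow_mul, show (5 : ℤ) ^ 2 = 25 by norm_num, ← gaussRot_pow_norm n]
  nlinarith [sq_nonneg (gaussRot ^ n).im]

theorem IsRotRecord.recordBound_lt {n : ℕ} (h : IsRotRecord n) (j : ℕ) (hj : j < n) :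
    5 ^ (n - j) * recordBound j < (gaussRot ^ n).re := by
  induction j with
  | zero =>
    have h5 : (0 : ℤ) < 5 ^ n := by positivity
    have := neg_five_pow_le_gaussRot_pow_re n
    simp only [recordBound, Nat.sub_zero]
    linarith
  | succ j ih =>
    rw [recordBound, mul_max_of_nonneg _ _ (by positivity), max_lt_iff]
    refine ⟨?_, h (j + 1) (by omega) hj⟩
    have := ih (by omega)
    rwa [show n - j = n - (j + 1) + 1 by omega, pow_succ, mul_assoc] at this

theorem IsRotRecord.exists_blockWord_mem {n : ℕ} (h : IsRotRecord n) :
    ∃ u, blockWord u n ∈ recordLanguage := by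
  choose u hu using fun j : ℕ =>
    exists_blockVec_eq ![(gaussRot ^ j).re, (gaussRot ^ j).im, recordBound j]
  refine ⟨u, (blockWord_mem_recordLanguage u n).2 ⟨fun j _ => ?_, fun _ => ?_, ?_⟩⟩
  · simp [hu, gaussRot_pow_succ_re, gaussRot_pow_succ_im, recordBound]
  · simp [hu]
  · rintro j rfl
    simpa [hu] using h.recordBound_lt j (by omega)

/-! ### Semialgebraic sets along a rational curve -/

/-- A polynomial along a curve with rational coordinates `P i / Q` is a rational function. -/
theorem MvPolynomial.exists_eval_div_mul_pow {ι : Type*} (P : ι → Polynomial ℝ)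
    (Q : Polynomial ℝ) (hQ : ∀ t, 0 < Q.eval t) (p : MvPolynomial ι ℝ) :
    ∃ (k : ℕ) (F : Polynomial ℝ),
      ∀ t, MvPolynomial.eval (fun i => (P i).eval t / Q.eval t) p * Q.eval t ^ k = F.eval t := by
  induction p using MvPolynomial.induction_on with
  | C a => exact ⟨0, Polynomial.C a, by simp⟩
  | add p q hp hq =>
    obtain ⟨k, F, hF⟩ := hp
    obtain ⟨l, G, hG⟩ := hq
    refine ⟨k + l, F * Q ^ l + G * Q ^ k, fun t => ?_⟩
    simp only [map_add, Polynomial.eval_add, Polynomial.eval_mul, Polynomial.eval_pow, ← hF, ← hG]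
    ring
  | mul_X p i hp =>
    obtain ⟨k, F, hF⟩ := hp
    refine ⟨k + 1, F * P i, fun t => ?_⟩
    have := (hQ t).ne'
    simp only [map_mul, MvPolynomial.eval_X, Polynomial.eval_mul, ← hF]
    field_simp
    ring

/-- The parameters at which a rational curve lies in a semialgebraic set form a subset of the line
with a finite boundary. -/
theorem IsSemialgebraic.finite_frontier_preimage {ι : Type*} {A : Set (ι → ℝ)}
    (hA : IsSemialgebraic A) (P : ι → Polynomial ℝ) (Q : Polynomial ℝ)
    (hQ : ∀ t, 0 < Q.eval t) :
    (frontier {t : ℝ | (fun i => (P i).eval t / Q.eval t) ∈ A}).Finite := by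
  induction hA with
  | pos p =>
    obtain ⟨k, F, hF⟩ := p.exists_eval_div_mul_pow P Q hQ
    have hset : {t : ℝ | (fun i => (P i).eval t / Q.eval t) ∈
        {x : ι → ℝ | 0 < MvPolynomial.eval x p}} = {t | 0 < F.eval t} := by
      ext t
      simp only [Set.mem_ofPred_eq, ← hF]
      exact (mul_pos_iff_of_pos_right (pow_pos (hQ t) k)).symm
    rw [hset]
    by_cases h0 : F = 0
    · simp [h0]
    · refine (F.roots.toFinset.finite_toSet).subset fun t ht => ?_
      have := frontier_lt_subset_eq continuous_const F.continuous ht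
      simpa [h0] using this.symm
  | compl _ ih => rwa [← frontier_compl] at ih
  | union _ _ ihA ihB =>
    refine (ihA.union ihB).subset ((frontier_union_subset _ _).trans ?_)
    exact Set.union_subset_union Set.inter_subset_left Set.inter_subset_right
  | inter _ _ ihA ihB =>
    refine (ihA.union ihB).subset ((frontier_inter_subset _ _).trans ?_)
    exact Set.union_subset_union Set.inter_subset_left Set.inter_subset_right

/-- A countable infinite set of parameters does not have a finite boundary, so a semialgebraic set
cannot meet a rational curve in such a set. -/
theorem not_isSemialgebraic_of_countable {ι : Type*} {A : Set (ι → ℝ)} (P : ι → Polynomial ℝ)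
    (Q : Polynomial ℝ) (hQ : ∀ t, 0 < Q.eval t)
    (hc : {t : ℝ | (fun i => (P i).eval t / Q.eval t) ∈ A}.Countable)
    (hi : {t : ℝ | (fun i => (P i).eval t / Q.eval t) ∈ A}.Infinite) :
    ¬ IsSemialgebraic A := by
  intro hA
  have hint : interior {t : ℝ | (fun i => (P i).eval t / Q.eval t) ∈ A} = ∅ :=
    interior_eq_empty_iff_dense_compl.2 (hc.dense_compl ℝ)
  refine hi ((hA.finite_frontier_preimage P Q hQ).subset fun t ht => ?_)
  exact ⟨subset_closure ht, by simp [hint]⟩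

/-! ### Sequences accumulating at a single point -/

/-- An infinite set of terms of an injective sequence that converge to `p` has the limit point `p`
and no other. -/
theorem derivedSet_image_of_tendsto {X : Type*} [TopologicalSpace X] [T2Space X] {x : ℕ → X}
    (hx : x.Injective) {R : Set ℕ} (hR : R.Infinite) {p : X}
    (hp : ∀ U ∈ 𝓝 p, {n ∈ R | x n ∉ U}.Finite) : derivedSet (x '' R) = {p} := by
  ext y
  rw [mem_derivedSet, accPt_iff_nhds, Set.mem_singleton_iff]
  constructor
  · intro h
    by_contra hy
    obtain ⟨U, V, hU, hV, hyU, hpV, hUV⟩ := t2_separation hy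
    have hfin := (hp V (hV.mem_nhds hpV)).image x
    obtain ⟨z, ⟨⟨hzU, hz⟩, n, hn, rfl⟩, hzy⟩ := h (U ∩ (x '' {n ∈ R | x n ∉ V} \ {y})ᶜ)
      (Filter.inter_mem (hU.mem_nhds hyU)
        ((hfin.subset Set.sdiff_subset).isClosed.isOpen_compl.mem_nhds (by simp)))
    refine hz ⟨⟨n, ⟨hn, fun hnV => ?_⟩, rfl⟩, hzy⟩
    exact Set.disjoint_left.1 hUV hzU hnV
  · rintro rfl U hU
    have hfin : ({n ∈ R | x n ∉ U} ∪ x ⁻¹' {y}).Finite :=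
      (hp U hU).union ((Set.finite_singleton y).preimage hx.injOn)
    obtain ⟨n, hn, hn'⟩ := (hR.sdiff hfin).nonempty
    simp only [Set.mem_union, Set.mem_ofPred_eq, not_or, not_and, not_not, Set.mem_preimage,
      Set.mem_singleton_iff] at hn'
    exact ⟨x n, ⟨hn'.1 hn, n, hn, rfl⟩, hn'.2⟩

/-! ### Records accumulate at the identity -/

/-- The complex number `(3 + 4i) / 5`. -/
noncomputable def rotNum : ℂ := GaussianInt.toComplex gaussRot / 5

theorem rotNum_eq : rotNum = ⟨3 / 5, 4 / 5⟩ := by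
  apply Complex.ext <;> simp [rotNum, gaussRot, GaussianInt.toComplex_def]

theorem rotNum_pow (n : ℕ) :
    rotNum ^ n = ⟨(gaussRot ^ n).re / 5 ^ n, (gaussRot ^ n).im / 5 ^ n⟩ := by
  have h : rotNum ^ n = GaussianInt.toComplex (gaussRot ^ n) / ((5 ^ n : ℝ) : ℂ) := by
    simp [rotNum, div_pow]
  rw [h]
  apply Complex.ext
  · rw [Complex.div_ofReal_re]; simp
  · rw [Complex.div_ofReal_im]; simp

theorem norm_rotNum : ‖rotNum‖ = 1 := by
  rw [← pow_eq_one_iff_of_nonneg (norm_nonneg _) two_ne_zero, rotNum_eq, Complex.sq_norm,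
    Complex.normSq_mk]
  norm_num

/-- Modulo `5` the positive powers of `3 + 4i` are all equal to `3 + 4i`. -/
theorem gaussRot_pow_succ_modEq (n : ℕ) :
    (gaussRot ^ (n + 1)).re ≡ 3 [ZMOD 5] ∧ (gaussRot ^ (n + 1)).im ≡ 4 [ZMOD 5] := by
  induction n with
  | zero => simp [gaussRot]
  | succ n ih =>
    rw [gaussRot_pow_succ_re (n + 1), gaussRot_pow_succ_im (n + 1)]
    obtain ⟨h1, h2⟩ := ih
    simp only [Int.ModEq] at *
    omega

theorem rotNum_pow_im_ne_zero {n : ℕ} (hn : n ≠ 0) : (rotNum ^ n).im ≠ 0 := by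
  obtain ⟨m, rfl⟩ := Nat.exists_eq_succ_of_ne_zero hn
  have h : (gaussRot ^ (m + 1)).im ≠ 0 := fun h => by
    have := (gaussRot_pow_succ_modEq m).2
    rw [h] at this
    exact absurd this (by decide)
  rw [rotNum_pow]
  exact div_ne_zero (Int.cast_ne_zero.2 h) (by positivity)

theorem rotNum_pow_injective : Function.Injective fun n : ℕ => rotNum ^ n := by
  have hne : rotNum ≠ 0 := norm_ne_zero_iff.1 (by rw [norm_rotNum]; exact one_ne_zero)
  have key : ∀ m d : ℕ, rotNum ^ m = rotNum ^ (m + d) → d = 0 := by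
    intro m d h
    by_contra hd
    rw [pow_add, left_eq_mul₀ (pow_ne_zero m hne)] at h
    exact rotNum_pow_im_ne_zero hd (by simp [h])
  intro m n h
  rcases le_total m n with hmn | hmn <;> obtain ⟨d, rfl⟩ := Nat.exists_eq_add_of_le hmn
  · simp [key m d h]
  · simp [key n d h.symm]

theorem isRotRecord_iff (n : ℕ) :
    IsRotRecord n ↔ ∀ m, 1 ≤ m → m < n → (rotNum ^ m).re < (rotNum ^ n).re := by
  refine forall_congr' fun m => forall_congr' fun _ => forall_congr' fun hmn => ?_
  rw [rotNum_pow, rotNum_pow, div_lt_div_iff₀ (by positivity) (by positivity)]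
  obtain ⟨d, rfl⟩ := Nat.exists_eq_add_of_le hmn.le
  have h5 : (0 : ℝ) < 5 ^ m := by positivity
  rw [show m + d - m = d by omega, pow_add (5 : ℝ),
    show (((gaussRot ^ m).re : ℝ)) * (5 ^ m * 5 ^ d) = 5 ^ d * (gaussRot ^ m).re * 5 ^ m by ring,
    mul_lt_mul_iff_left₀ h5]
  exact_mod_cast Iff.rfl

theorem normSq_rotNum_pow (n : ℕ) : (rotNum ^ n).re ^ 2 + (rotNum ^ n).im ^ 2 = 1 := by
  have h : ‖rotNum ^ n‖ = 1 := by rw [norm_pow, norm_rotNum, one_pow]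
  have := Complex.sq_norm (rotNum ^ n)
  rw [h, Complex.normSq_apply] at this
  linarith

theorem rotNum_pow_re_lt_one {n : ℕ} (hn : n ≠ 0) : (rotNum ^ n).re < 1 := by
  have h1 := normSq_rotNum_pow n
  have h2 := pow_pos (abs_pos.2 (rotNum_pow_im_ne_zero hn)) 2
  rw [sq_abs] at h2
  nlinarith

/-- By compactness of the circle, two powers of `(3 + 4i) / 5` are close to each other, and so is
their quotient to `1`. -/
theorem exists_rotNum_pow_re_gt {r : ℝ} (hr : r < 1) : ∃ n, 1 ≤ n ∧ r < (rotNum ^ n).re := by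
  obtain ⟨z, -, f, hf, hz⟩ := (isCompact_sphere (0 : ℂ) 1).tendsto_subseq
    (x := fun n : ℕ => rotNum ^ n) (by simp [norm_rotNum])
  obtain ⟨N, hN⟩ := Metric.cauchySeq_iff.1 hz.cauchySeq (1 - r) (by linarith)
  have hlt : f N < f (N + 1) := hf N.lt_succ_self
  refine ⟨f (N + 1) - f N, by omega, ?_⟩
  have h := hN N le_rfl (N + 1) (by omega)
  obtain ⟨d, hd⟩ := Nat.exists_eq_add_of_le hlt.le
  rw [hd, Nat.add_sub_cancel_left]
  simp only [Function.comp_apply, hd, dist_eq_norm, pow_add] at h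
  rw [show rotNum ^ f N - rotNum ^ f N * rotNum ^ d = rotNum ^ f N * (1 - rotNum ^ d) by ring,
    norm_mul, norm_pow, norm_rotNum, one_pow, one_mul] at h
  have := (Complex.re_le_norm (1 - rotNum ^ d))
  simp only [Complex.sub_re, Complex.one_re] at this
  linarith

theorem infinite_setOf_isRotRecord : {n | IsRotRecord n}.Infinite := by
  classical
  rw [Set.infinite_iff_exists_gt]
  intro K
  -- The first power whose real part exceeds those of all exponents up to `K` is a record.
  obtain ⟨C, hC, hCK⟩ : ∃ C < 1, ∀ m, 1 ≤ m → m ≤ K → (rotNum ^ m).re ≤ C := by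
    induction K with
    | zero => exact ⟨0, one_pos, fun m h1 h2 => by omega⟩
    | succ K ih =>
      obtain ⟨C, hC, h⟩ := ih
      refine ⟨max C (rotNum ^ (K + 1)).re, max_lt hC (rotNum_pow_re_lt_one (by omega)), ?_⟩
      intro m h1 h2
      rcases Nat.lt_or_ge K m with hm | hm
      · obtain rfl : m = K + 1 := by omega
        exact le_max_right _ _
      · exact le_max_of_le_left (h m h1 hm)
  have hex := exists_rotNum_pow_re_gt hC
  obtain ⟨h1, h2⟩ := Nat.find_spec hex
  refine ⟨Nat.find hex, (isRotRecord_iff _).2 fun m hm hmn => ?_, ?_⟩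
  · have := Nat.find_min hex hmn
    push Not at this
    exact (this hm).trans_lt h2
  · by_contra! hle
    exact (hCK _ h1 hle).not_gt h2

/-- All but finitely many records have a real part above any given number less than `1`. -/
theorem finite_isRotRecord_re_le {r : ℝ} (hr : r < 1) :
    {n | IsRotRecord n ∧ (rotNum ^ n).re ≤ r}.Finite := by
  obtain ⟨m, hm, hrm⟩ := exists_rotNum_pow_re_gt hr
  refine (Set.finite_le_nat m).subset fun n hn => ?_
  by_contra hmn
  have := (isRotRecord_iff n).1 hn.1 m hm (not_le.1 hmn)
  linarith [hn.2]

theorem finite_isRotRecord_notMem {U : Set ℂ} (hU : U ∈ 𝓝 1) :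
    {n | IsRotRecord n ∧ rotNum ^ n ∉ U}.Finite := by
  obtain ⟨ε, hε, hball⟩ := Metric.mem_nhds_iff.1 hU
  refine (finite_isRotRecord_re_le (r := 1 - ε ^ 2 / 2) (by nlinarith)).subset fun n hn => ?_
  refine ⟨hn.1, ?_⟩
  by_contra! hlt
  refine hn.2 (hball ?_)
  rw [Metric.mem_ball, dist_eq_norm]
  refine lt_of_pow_lt_pow_left₀ 2 hε.le ?_
  have := normSq_rotNum_pow n
  rw [Complex.sq_norm, Complex.normSq_apply]
  simp only [Complex.sub_re, Complex.one_re, Complex.sub_im, Complex.one_im]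
  nlinarith

/-! ### The matrices of the records -/

/-- The real matrix of the multiplication by a complex number. -/
def mulMatrix (z : ℂ) : Matrix (Fin 2) (Fin 2) ℝ := !![z.re, z.im; -z.im, z.re]

theorem mulMatrix_injective : Function.Injective mulMatrix := by
  intro z w h
  have h0 := congrFun (congrFun h 0) 0
  have h1 := congrFun (congrFun h 0) 1
  simp only [mulMatrix, Matrix.of_apply, Matrix.cons_val', Matrix.cons_val_zero,
    Matrix.cons_val_one] at h0 h1
  exact Complex.ext h0 h1

theorem continuous_mulMatrix : Continuous mulMatrix := by
  refine continuous_matrix fun i j => ?_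
  fin_cases i <;> fin_cases j <;> simp [mulMatrix] <;> fun_prop

theorem mulMatrix_one : mulMatrix 1 = 1 := by
  simp [mulMatrix, Matrix.one_fin_two]

theorem mulMatrix_mul (z w : ℂ) : mulMatrix (z * w) = mulMatrix z * mulMatrix w := by
  simp only [mulMatrix, Matrix.mul_fin_two, Complex.mul_re, Complex.mul_im]
  congr! 3 <;> ring_nf

/-- The matrices of the powers of the rotation whose exponent is a record. -/
def recordMatrices : Set (Matrix (Fin 2) (Fin 2) ℝ) :=
  (fun n : ℕ => mulMatrix (rotNum ^ n)) '' {n | IsRotRecord n}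

theorem mulMatrix_rotNum_pow_injective :
    Function.Injective fun n : ℕ => mulMatrix (rotNum ^ n) :=
  mulMatrix_injective.comp rotNum_pow_injective

theorem derivedSet_recordMatrices : derivedSet recordMatrices = {1} := by
  refine derivedSet_image_of_tendsto mulMatrix_rotNum_pow_injective infinite_setOf_isRotRecord
    fun U hU => ?_
  refine finite_isRotRecord_notMem (U := mulMatrix ⁻¹' U) ?_
  refine continuous_mulMatrix.continuousAt.preimage_mem_nhds ?_
  rwa [mulMatrix_one]

theorem closure_recordMatrices : closure recordMatrices = recordMatrices := by
  rw [closure_eq_self_union_derivedSet, derivedSet_recordMatrices, Set.union_eq_left,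
    Set.singleton_subset_iff]
  exact ⟨0, fun m hm hm0 => absurd hm0 (Nat.not_lt_zero m), by simp [mulMatrix_one]⟩

theorem infinite_recordMatrices : recordMatrices.Infinite :=
  infinite_setOf_isRotRecord.image mulMatrix_rotNum_pow_injective.injOn

/-- The rational parametrization `t ↦ ((1 - t ^ 2) / (1 + t ^ 2), 2 t / (1 + t ^ 2))` of the circle
meets the matrices of the records in a countable infinite set. -/
theorem not_isSemialgebraicMatrixSet_recordMatrices :
    ¬ IsSemialgebraicMatrixSet recordMatrices := by
  let X : Polynomial ℝ := Polynomial.X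
  let P : Fin 2 × Fin 2 → Polynomial ℝ := fun p => !![1 - X ^ 2, 2 * X; -(2 * X), 1 - X ^ 2] p.1 p.2
  let Q : Polynomial ℝ := 1 + X ^ 2
  have hQ : ∀ t, 0 < Q.eval t := fun t => by
    simp only [Q, X, Polynomial.eval_add, Polynomial.eval_one, Polynomial.eval_pow,
      Polynomial.eval_X]
    positivity
  let z : ℝ → ℂ := fun t => ⟨(1 - t ^ 2) / (1 + t ^ 2), 2 * t / (1 + t ^ 2)⟩
  have hmem : {t : ℝ | (fun i => (P i).eval t / Q.eval t) ∈
      {x : Fin 2 × Fin 2 → ℝ | Matrix.of (fun i j => x (i, j)) ∈ recordMatrices}} =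
      {t | mulMatrix (z t) ∈ recordMatrices} := by
    ext t
    simp only [Set.mem_ofPred_eq]
    have : (Matrix.of fun i j => (P (i, j)).eval t / Q.eval t) = mulMatrix (z t) := by
      ext i j
      fin_cases i <;> fin_cases j <;> simp [P, Q, X, z, mulMatrix, neg_div]
    rw [this]
  -- The parameter of a point of the circle is `im / (1 + re)`.
  have hparam : ∀ t, (z t).im / (1 + (z t).re) = t := fun t => by
    have : (1 : ℝ) + t ^ 2 ≠ 0 := by positivity
    simp only [z]
    field_simp
    ring
  have hinj : Function.Injective z := fun s t h => by rw [← hparam s, h, hparam t]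
  have hcurve : ∀ n : ℕ, ∃ t, z t = rotNum ^ n := by
    intro n
    have h1 := normSq_rotNum_pow n
    have hpos : 0 < 1 + (rotNum ^ n).re := by
      rcases eq_or_ne n 0 with rfl | hn
      · simp
      · have h2 := pow_pos (abs_pos.2 (rotNum_pow_im_ne_zero hn)) 2
        rw [sq_abs] at h2
        nlinarith
    refine ⟨(rotNum ^ n).im / (1 + (rotNum ^ n).re), ?_⟩
    generalize (rotNum ^ n) = w at *
    have hden : 1 + (w.im / (1 + w.re)) ^ 2 = 2 / (1 + w.re) := by
      field_simp
      linarith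
    apply Complex.ext
    · simp only [z, hden]
      field_simp
      linarith
    · simp only [z, hden]
      field_simp
  refine not_isSemialgebraic_of_countable P Q hQ ?_ ?_
  · rw [hmem]
    exact ((Set.to_countable _).image _).preimage (mulMatrix_injective.comp hinj)
  · rw [hmem]
    choose t ht using hcurve
    have htinj : Function.Injective t := fun m n h =>
      rotNum_pow_injective (by simp only [← ht, h])
    refine (infinite_setOf_isRotRecord.image htinj.injOn).mono ?_
    rintro _ ⟨n, hn, rfl⟩
    exact ⟨n, hn, by simp only [ht]⟩

/-! ### The language and its morphism -/

/-- The morphism that maps the separator to the rotation and every other letter to the identity. -/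
def blockMorphism : FreeMonoid BlockLetter →* Matrix (Fin 2) (Fin 2) ℚ :=
  FreeMonoid.lift fun
    | none => !![3 / 5, 4 / 5; -4 / 5, 3 / 5]
    | some _ => 1

theorem blockMorphism_mem_orthogonalGroup (w : FreeMonoid BlockLetter) :
    blockMorphism w ∈ Matrix.orthogonalGroup (Fin 2) ℚ := by
  induction w using FreeMonoid.inductionOn with
  | one => rw [map_one]; exact one_mem _
  | of c =>
    rcases c with _ | c
    · rw [Matrix.mem_orthogonalGroup_iff]
      ext i j
      fin_cases i <;> fin_cases j <;>
        norm_num [blockMorphism, Matrix.mul_apply, Fin.sum_univ_two, Matrix.star_apply]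
    · simp only [blockMorphism, FreeMonoid.lift_eval_of]
      exact one_mem _
  | mul v w hv hw => rw [map_mul]; exact mul_mem hv hw

theorem blockMorphism_blockWord (u : ℕ → List (Fin 3 × Bool)) (n : ℕ) :
    (blockMorphism (FreeMonoid.ofList (blockWord u n))).map (fun r : ℚ => (r : ℝ)) =
      mulMatrix (rotNum ^ n) := by
  have hblock : ∀ v : List (Fin 3 × Bool),
      blockMorphism (FreeMonoid.ofList (v.map some)) = 1 := by
    intro v
    induction v with
    | nil => exact map_one _
    | cons c v ih =>
      rw [List.map_cons, FreeMonoid.ofList_cons, map_mul, ih]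
      simp [blockMorphism]
  have hrot : (!![3 / 5, 4 / 5; -4 / 5, 3 / 5] : Matrix (Fin 2) (Fin 2) ℚ).map
      (fun r : ℚ => (r : ℝ)) = mulMatrix rotNum := by
    ext i j
    fin_cases i <;> fin_cases j <;> simp [mulMatrix, rotNum_eq, neg_div]
  induction n generalizing u with
  | zero =>
    rw [blockWord, hblock, pow_zero, mulMatrix_one]
    exact Matrix.map_one _ Rat.cast_zero Rat.cast_one
  | succ n ih =>
    rw [blockWord, FreeMonoid.ofList_append, FreeMonoid.ofList_cons, map_mul, map_mul, hblock,
      one_mul, pow_succ', mulMatrix_mul, ← ih fun j => u (j + 1), ← hrot]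
    exact Matrix.map_mul (f := Rat.castHom ℝ)

theorem matrixImage_recordLanguage :
    matrixImage blockMorphism recordLanguage = recordMatrices := by
  ext A
  constructor
  · rintro ⟨w, hw, rfl⟩
    obtain ⟨u, n, rfl⟩ := exists_blockWord_eq w
    exact ⟨n, IsRotRecord.of_blockWord_mem hw, (blockMorphism_blockWord u n).symm⟩
  · rintro ⟨n, hn, rfl⟩
    obtain ⟨u, hu⟩ := IsRotRecord.exists_blockWord_mem hn
    exact ⟨_, hu, (blockMorphism_blockWord u n).symm⟩

theorem mainTheorem3 :
    ∃ (Γ : Type) (_ : Finite Γ) (q : Γ) (L : Language Γ)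
      (φ : FreeMonoid Γ →* Matrix (Fin 2) (Fin 2) ℚ),
      φ (FreeMonoid.of q) = !![3 / 5, 4 / 5; -4 / 5, 3 / 5] ∧
      (∀ c : Γ, c ≠ q → φ (FreeMonoid.of c) = 1) ∧
      (∀ w : FreeMonoid Γ, φ w ∈ Matrix.orthogonalGroup (Fin 2) ℚ) ∧
      Lᶜ.IsContextFree ∧
      ¬ IsSemialgebraicMatrixSet (closure (matrixImage φ L)) ∧
      derivedSet (closure (matrixImage φ L)) = {1} ∧
      (closure (matrixImage φ L) \ derivedSet (closure (matrixImage φ L))).Infinite := by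
  refine ⟨BlockLetter, inferInstance, none, recordLanguage, blockMorphism, ?_, ?_,
    blockMorphism_mem_orthogonalGroup, isContextFree_compl_recordLanguage, ?_⟩
  · simp [blockMorphism]
  · rintro (_ | c) hc
    · exact absurd rfl hc
    · simp [blockMorphism]
  · rw [matrixImage_recordLanguage, closure_recordMatrices, derivedSet_recordMatrices]
    exact ⟨not_isSemialgebraicMatrixSet_recordMatrices, rfl,
      infinite_recordMatrices.sdiff (Set.finite_singleton 1)⟩
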